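/- Let $L$ be a first-order language and let $\mathcal U$ be a saturated $L$-structure whose cardinality $\kappa$ is an (uncountable, strongly) inaccessible cardinal with $\kappa>|L|$. Let $A\subseteq\mathcal U$ be a set of cardinality $<\kappa$, let $n$ be a natural number and let $\mathcal D\subseteq\mathcal U^{n}$ be an arbitrary set of $n$-tuples. Let $$o(\mathcal D/A)=\{f[\mathcal D] : f\in\mathrm{Aut}(\mathcal U/A)\}$$ be the orbit of $\mathcal D$ under the group $\mathrm{Aut}(\mathcal U/A)$ of automorphisms of $\mathcal U$ that fix $A$ pointwise, and let $|L(A)|$ be the number of first-order $L$-formulas with parameters from $A$. Then the following are equivalent: 1. $o(\mathcal D/A)$ has cardinality $<\kappa$; 2. $o(\mathcal D/A)$ has cardinality $\le 2^{2^{|L(A)|}}$. -/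

import Mathlib

open FirstOrder Cardinal

universe u v w

namespace LascarOrbit

/-- A structure `U` is saturated if, for every set of parameters `A ⊆ U` of cardinality smaller
than that of `U`, every finitely consistent set of formulas over `A` in finitely many variables
is realized in `U`. -/
def IsSaturated (L : FirstOrder.Language.{u, v}) (U : Type w) [L.Structure U] : Prop :=
  ∀ A : Set U, #A < #U → ∀ (n : ℕ) (p : Set (L[[A]].Formula (Fin n))),
    (∀ q : Finset (L[[A]].Formula (Fin n)), (q : Set (L[[A]].Formula (Fin n))) ⊆ p →
      ∃ x : Fin n → U, ∀ φ ∈ q, φ.Realize x) →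
    ∃ x : Fin n → U, ∀ φ ∈ p, φ.Realize x

/-- `|L(A)|`: the number of first-order formulas (in countably many variables) with
parameters from `A`. -/
def cardFormulas (L : FirstOrder.Language.{u, v}) {U : Type w} (A : Set U) : Cardinal.{max u v w} :=
  #(L[[A]].Formula ℕ)

/-- The orbit `o(D/A) = { f[D] : f ∈ Aut(U/A) }` of a set `D` of `n`-tuples, where `Aut(U/A)`
consists of the automorphisms of `U` that fix `A` pointwise. -/
def orbit (L : FirstOrder.Language.{u, v}) {U : Type w} [L.Structure U] {n : ℕ} (A : Set U)
    (D : Set (Fin n → U)) : Set (Set (Fin n → U)) :=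
  {C | ∃ f : U ≃[L] U, (∀ a ∈ A, f a = a) ∧ C = (fun t : Fin n → U => f ∘ t) '' D}

end LascarOrbit

/-! The bound implies smallness because `#U` is a strong limit above `|L(A)|`. For the converse, let
M ≼ U contain A with |M| = |L(A)|, and call two tuples equivalent when they lie in the same members
of the orbit. A small orbit gives fewer than `#U` classes, and automorphisms fixing A permute the
orbit, so the relation is bounded and invariant. Such a relation is coarser than equality of types
over M (`IsSaturated.rel_of_sameType`): realize a coheir c of tp(a/M) over representatives of all
relevant classes; c is then equivalent to every realization of tp(a/M) among the parameters. Hence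
each member of the orbit is determined by the set of types over M that it realizes. -/

namespace LascarOrbit

open FirstOrder.Language Set Filter

variable {L : FirstOrder.Language.{u, v}} {U : Type w} [L.Structure U]

/-! ### Types of tuples and saturation. -/

/-- Two tuples have the same type if they satisfy the same formulas. -/
def SameType (L : FirstOrder.Language.{u, v}) {U : Type w} [L.Structure U] {I : Type*}
    (a b : I → U) : Prop :=
  ∀ φ : L.Formula I, φ.Realize a ↔ φ.Realize b

namespace SameType

variable {I J : Type*} {a b c : I → U}

theorem symm (h : SameType L a b) : SameType L b a := fun φ => (h φ).symm

theorem trans (h : SameType L a b) (h' : SameType L b c) : SameType L a c :=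
  fun φ => (h φ).trans (h' φ)

theorem comp (h : SameType L a b) (g : J → I) : SameType L (a ∘ g) (b ∘ g) := fun φ => by
  simpa only [Formula.realize_relabel] using h (φ.relabel g)

theorem of_imp (h : ∀ φ : L.Formula I, φ.Realize a → φ.Realize b) : SameType L a b :=
  fun φ => ⟨h φ, fun hb => by
    by_contra ha
    exact Formula.realize_not.1 (h φ.not (Formula.realize_not.2 ha)) hb⟩

theorem of_finset (h : ∀ s : Finset I, SameType L (fun i : s => a i) (fun i : s => b i)) :
    SameType L a b := fun φ => by
  classical
  have key : ∀ a : I → U, Formula.Realize (φ.restrictFreeVar id) (fun i => a i) ↔ φ.Realize a :=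
    fun a => BoundedFormula.realize_restrictFreeVar a fun _ => rfl
  exact (key a).symm.trans ((h _ _).trans (key b))

theorem eq_iff (h : SameType L a b) (i j : I) : a i = a j ↔ b i = b j := by
  simpa using h (Term.equal (Term.var i) (Term.var j))

end SameType

/-- Trades constants for free variables indexed by `I`; only the range of `b` must be small. -/
theorem IsSaturated.exists_realize (h : IsSaturated L U) {I : Type*} (b : I → U)
    (hb : #(range b) < #U) {n : ℕ} (p : Set (L.Formula (I ⊕ Fin n)))
    (hp : ∀ q : Finset (L.Formula (I ⊕ Fin n)), (q : Set (L.Formula (I ⊕ Fin n))) ⊆ p →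
      ∃ x : Fin n → U, ∀ φ ∈ q, φ.Realize (Sum.elim b x)) :
    ∃ x : Fin n → U, ∀ φ ∈ p, φ.Realize (Sum.elim b x) := by
  classical
  let T : L.Formula (I ⊕ Fin n) → L[[range b]].Formula (Fin n) := fun φ =>
    BoundedFormula.constantsVarsEquiv.symm (φ.relabel (Sum.map (rangeFactorization b) id))
  have hT : ∀ φ (x : Fin n → U), (T φ).Realize x ↔ φ.Realize (Sum.elim b x) := fun φ x => by
    rw [Formula.Realize, ← BoundedFormula.realize_constantsVarsEquiv, Equiv.apply_symm_apply]
    change Formula.Realize _ _ ↔ _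
    rw [Formula.realize_relabel]
    refine iff_of_eq (congrArg _ (funext fun i => ?_))
    cases i <;> simp
  obtain ⟨x, hx⟩ := h (range b) hb n (T '' p) fun q hq => by
    obtain ⟨q', hq', rfl⟩ := Finset.subset_set_image_iff.1 hq
    obtain ⟨x, hx⟩ := hp q' hq'
    refine ⟨x, fun φ hφ => ?_⟩
    obtain ⟨ψ, hψ, rfl⟩ := Finset.mem_image.1 hφ
    exact (hT ψ x).2 (hx ψ hψ)
  exact ⟨x, fun φ hφ => (hT φ x).1 (hx _ (mem_image_of_mem T hφ))⟩

theorem IsSaturated.exists_sameType_elim (h : IsSaturated L U) {I : Type w} {a b : I → U}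
    (hab : SameType L a b) (hI : #I < #U) {n : ℕ} (x : Fin n → U) :
    ∃ y : Fin n → U, SameType L (Sum.elim a x) (Sum.elim b y) := by
  obtain ⟨y, hy⟩ := h.exists_realize b (mk_range_le.trans_lt hI)
    {φ : L.Formula (I ⊕ Fin n) | φ.Realize (Sum.elim a x)} fun q hq => by
      have := (hab ((Formula.iInf fun φ : q => φ.1).iExs (Fin n))).1
        (Formula.realize_iExs.2 ⟨x, Formula.realize_iInf.2 fun φ => hq φ.2⟩)
      obtain ⟨y, hy⟩ := Formula.realize_iExs.1 this
      exact ⟨y, fun φ hφ => Formula.realize_iInf.1 hy ⟨φ, hφ⟩⟩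
  exact ⟨y, .of_imp hy⟩

/-! ### Partial elementary maps and back-and-forth. -/

/-- A binary relation on `U` is elementary if it is the graph of a partial elementary map. -/
def IsElementaryRel (L : FirstOrder.Language.{u, v}) {U : Type w} [L.Structure U]
    (R : Set (U × U)) : Prop :=
  SameType L (fun p : R => p.1.1) (fun p : R => p.1.2)

namespace IsElementaryRel

variable {R S : Set (U × U)}

theorem mono (h : IsElementaryRel L S) (hRS : R ⊆ S) : IsElementaryRel L R :=
  SameType.comp h (inclusion hRS)

theorem of_finset
    (h : ∀ s : Finset (U × U), (s : Set (U × U)) ⊆ R → IsElementaryRel L (s : Set (U × U))) :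
    IsElementaryRel L R := by
  classical
  refine SameType.of_finset fun s => ?_
  have := h (s.image Subtype.val) (by simp)
  exact SameType.comp this fun i : s => ⟨i.1.1, by simp⟩

theorem swap (h : IsElementaryRel L R) : IsElementaryRel L (Prod.swap ⁻¹' R) :=
  (SameType.comp h fun p : (Prod.swap ⁻¹' R : Set (U × U)) => (⟨p.1.swap, p.2⟩ : R)).symm

theorem exists_insert_right (h : IsElementaryRel L R) (hsat : IsSaturated L U) (hR : #R < #U)
    (x : U) : ∃ y, IsElementaryRel L (insert (x, y) R) := by
  classical
  obtain ⟨y, hy⟩ := hsat.exists_sameType_elim h hR (fun _ : Fin 1 => x)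
  refine ⟨y 0, ?_⟩
  unfold IsElementaryRel
  convert hy.comp (fun p : (insert (x, y 0) R : Set (U × U)) =>
    if hp : p.1 ∈ R then Sum.inl (⟨p.1, hp⟩ : R) else Sum.inr 0) using 1 <;>
  · funext ⟨p, hp⟩
    by_cases hpR : p ∈ R
    · simp [hpR]
    · obtain rfl := hp.resolve_right hpR
      simp [hpR]

theorem exists_insert_left (h : IsElementaryRel L R) (hsat : IsSaturated L U) (hR : #R < #U)
    (y : U) : ∃ x, IsElementaryRel L (insert (x, y) R) := by
  have hR' : #(Prod.swap ⁻¹' R : Set (U × U)) < #U := by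
    rwa [← image_swap_eq_preimage_swap, mk_image_eq Prod.swap_injective]
  obtain ⟨x, hx⟩ := h.swap.exists_insert_right hsat hR' y
  refine ⟨x, hx.swap.mono ?_⟩
  rintro ⟨p, q⟩ hp
  simpa [and_comm] using hp

theorem exists_insert_insert (h : IsElementaryRel L R) (hsat : IsSaturated L U) (hU : ℵ₀ ≤ #U)
    (hR : #R < #U) (u : U) :
    ∃ q : U × U, IsElementaryRel L (insert (u, q.1) (insert (q.2, u) R)) := by
  obtain ⟨x, hx⟩ := h.exists_insert_left hsat hR u
  obtain ⟨y, hy⟩ := hx.exists_insert_right hsat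
    ((mk_insert_le).trans_lt (add_lt_of_lt hU hR (one_lt_aleph0.trans_le hU))) u
  exact ⟨(y, x), hy⟩

/-- A total and surjective elementary relation is the graph of an automorphism. -/
theorem exists_equiv (h : IsElementaryRel L R) (h₁ : ∀ x, ∃ y, (x, y) ∈ R)
    (h₂ : ∀ y, ∃ x, (x, y) ∈ R) : ∃ f : U ≃[L] U, ∀ p ∈ R, f p.1 = p.2 := by
  choose f hf using h₁
  have hfun : ∀ p ∈ R, f p.1 = p.2 := fun p hp =>
    (SameType.eq_iff h ⟨(p.1, f p.1), hf p.1⟩ ⟨p, hp⟩).1 rfl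
  have hst : SameType L (id : U → U) f := SameType.comp h fun x : U => ⟨(x, f x), hf x⟩
  have hbij : Function.Bijective f :=
    ⟨fun x y hxy => (hst.eq_iff x y).2 hxy, fun y => (h₂ y).imp fun x hx => hfun _ hx⟩
  refine ⟨⟨Equiv.ofBijective f hbij, fun {n} F x => ?_, fun {n} r x => ?_⟩, hfun⟩
  · have := hst (Term.equal (Term.var (Structure.funMap F x)) (Term.func F fun i => Term.var (x i)))
    simpa [Function.comp_def] using this
  · have := (hst (r.formula fun i => Term.var (x i)))
    simpa [Formula.realize_rel, Function.comp_def] using this.symm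

theorem biUnion {ι : Type*} {T : Set ι} (hT : T.Nonempty) {S : ι → Set (U × U)}
    (hd : DirectedOn (fun i j => S i ⊆ S j) T) (h : ∀ i ∈ T, IsElementaryRel L (S i)) :
    IsElementaryRel L (⋃ i ∈ T, S i) :=
  of_finset fun _ hs =>
    let ⟨i, hi, hsi⟩ := hd.exists_mem_subset_of_finset_subset_biUnion hT hs
    (h i hi).mono hsi

/-- Transfinite back-and-forth along a well-order of `U` of least type, so that every stage is
small. -/
theorem exists_total (h : IsElementaryRel L R) (hsat : IsSaturated L U) (hU : ℵ₀ ≤ #U)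
    (hR : #R < #U) : ∃ S, R ⊆ S ∧ IsElementaryRel L S ∧ (∀ x, ∃ y, (x, y) ∈ S) ∧
      ∀ y, ∃ x, (x, y) ∈ S := by
  classical
  obtain ⟨_, _, ho⟩ := Cardinal.exists_ord_eq_type_lt U
  let step (S : Set (U × U)) (u : U) : U × U :=
    if h : ∃ q : U × U, IsElementaryRel L (insert (u, q.1) (insert (q.2, u) S)) then h.choose
    else (u, u)
  -- `G u` is the pair (image of `u`, preimage of `u`); the default in `step` is never reached.
  let G : U → U × U := (wellFounded_lt (α := U)).fix fun u ih =>
    step (R ∪ (range (fun v : Iio u => (v.1, (ih v.1 v.2).1)) ∪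
      range (fun v : Iio u => ((ih v.1 v.2).2, v.1)))) u
  let S (T : Set U) : Set (U × U) :=
    R ∪ (range (fun v : T => (v.1, (G v.1).1)) ∪ range (fun v : T => ((G v.1).2, v.1)))
  have hG : ∀ u, G u = step (S (Iio u)) u := fun u => WellFounded.fix_eq _ _ _
  have hScard : ∀ u, #(S (Iio u)) < #U := fun u => by
    have hlt := mk_Iio_lt u ho
    exact (mk_union_le _ _).trans_lt (add_lt_of_lt hU hR ((mk_union_le _ _).trans_lt
      (add_lt_of_lt hU (mk_range_le.trans_lt hlt) (mk_range_le.trans_lt hlt))))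
  have hSmono : Monotone S := fun T T' hTT' => by
    refine union_subset_union_right _ (union_subset_union ?_ ?_) <;>
    · rintro _ ⟨v, rfl⟩
      exact ⟨⟨v.1, hTT' v.2⟩, rfl⟩
  have hIic : ∀ u, IsElementaryRel L (S (Iio u)) → IsElementaryRel L (S (Iic u)) := fun u hu => by
    have hex := hu.exists_insert_insert hsat hU (hScard u) u
    have hGu : G u = hex.choose := (hG u).trans (dif_pos hex)
    have := hex.choose_spec
    rw [← hGu] at this
    refine this.mono ?_
    rintro p (hp | ⟨⟨v, hv⟩, rfl⟩ | ⟨⟨v, hv⟩, rfl⟩)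
    · exact .inr (.inr (.inl hp))
    · rcases (mem_Iic.1 hv).eq_or_lt with rfl | hv
      · exact .inl rfl
      · exact .inr (.inr (.inr (.inl ⟨⟨v, hv⟩, rfl⟩)))
    · rcases (mem_Iic.1 hv).eq_or_lt with rfl | hv
      · exact .inr (.inl rfl)
      · exact .inr (.inr (.inr (.inr ⟨⟨v, hv⟩, rfl⟩)))
  have hunion : ∀ T : Set U, (∀ u ∈ T, IsElementaryRel L (S (Iio u))) →
      IsElementaryRel L (S T) := fun T hT => by
    rcases T.eq_empty_or_nonempty with rfl | hne
    · refine h.mono ?_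
      rintro p (hp | ⟨⟨v, hv⟩, rfl⟩ | ⟨⟨v, hv⟩, rfl⟩)
      exacts [hp, hv.elim, hv.elim]
    -- Closed segments are needed: `S (Iio u)` omits the pairs added at `u` itself.
    · have hd : DirectedOn (fun u v => S (Iic u) ⊆ S (Iic v)) T := fun u hu v hv => by
        rcases le_total u v with huv | huv
        · exact ⟨v, hv, hSmono (Iic_subset_Iic.2 huv), subset_rfl⟩
        · exact ⟨u, hu, subset_rfl, hSmono (Iic_subset_Iic.2 huv)⟩
      refine (biUnion hne hd fun u hu => hIic u (hT u hu)).mono ?_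
      rintro p (hp | ⟨⟨v, hv⟩, rfl⟩ | ⟨⟨v, hv⟩, rfl⟩)
      · obtain ⟨u, hu⟩ := hne
        exact mem_biUnion hu (.inl hp)
      · exact mem_biUnion hv (.inr (.inl ⟨⟨v, le_rfl⟩, rfl⟩))
      · exact mem_biUnion hv (.inr (.inr ⟨⟨v, le_rfl⟩, rfl⟩))
  have hIio : ∀ u, IsElementaryRel L (S (Iio u)) := fun u => by
    induction u using WellFoundedLT.induction with
    | ind u ih => exact hunion _ ih
  exact ⟨S univ, subset_union_left, hunion _ fun u _ => hIio u,
    fun x => ⟨(G x).1, .inr (.inl ⟨⟨x, mem_univ x⟩, rfl⟩)⟩,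
    fun y => ⟨(G y).2, .inr (.inr ⟨⟨y, mem_univ y⟩, rfl⟩)⟩⟩

end IsElementaryRel

/-- Saturated structures are strongly homogeneous. -/
theorem IsSaturated.exists_equiv (hsat : IsSaturated L U) (hU : ℵ₀ ≤ #U) {I : Type w}
    (hI : #I < #U) {a b : I → U} (hab : SameType L a b) :
    ∃ f : U ≃[L] U, ∀ i, f (a i) = b i := by
  have hR : IsElementaryRel L (range fun i => (a i, b i)) := by
    have := hab.comp fun p : range fun i => (a i, b i) => p.2.choose
    unfold IsElementaryRel
    convert this using 1 <;>
    · funext p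
      conv_lhs => rw [← p.2.choose_spec]
      rfl
  obtain ⟨S, hRS, hS, h₁, h₂⟩ := hR.exists_total hsat hU (mk_range_le.trans_lt hI)
  obtain ⟨f, hf⟩ := hS.exists_equiv h₁ h₂
  exact ⟨f, fun i => hf _ (hRS ⟨i, rfl⟩)⟩

/-! ### Coheirs and bounded invariant equivalence relations. -/

/-- For every ultrafilter `F` on `n`-tuples, the global type of `F` restricted to a small set is
realized. -/
theorem IsSaturated.exists_realize_ultrafilter (hsat : IsSaturated L U) {n : ℕ}
    (F : Ultrafilter (Fin n → U)) {B : Set U} (hB : #B < #U) :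
    ∃ c : Fin n → U, ∀ (I : Type w) (b : I → U), (∀ i, b i ∈ B) → ∀ φ : L.Formula (I ⊕ Fin n),
      φ.Realize (Sum.elim b c) ↔ ∀ᶠ m in F, φ.Realize (Sum.elim b m) := by
  obtain ⟨c, hc⟩ := hsat.exists_realize (Subtype.val : B → U) (by simpa using hB)
    {φ : L.Formula (B ⊕ Fin n) | ∀ᶠ m in F, φ.Realize (Sum.elim Subtype.val m)} fun q hq =>
      ((eventually_all_finset q).2 fun φ hφ => hq hφ).exists
  refine ⟨c, fun I b hb φ => ?_⟩
  have key : ∀ (ψ : L.Formula (I ⊕ Fin n)) (x : Fin n → U),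
      (ψ.relabel (Sum.map (fun i => (⟨b i, hb i⟩ : B)) id)).Realize (Sum.elim Subtype.val x) ↔
        ψ.Realize (Sum.elim b x) := fun ψ x => by
    rw [Formula.realize_relabel, Sum.elim_comp_map]
    rfl
  have hmp : ∀ ψ : L.Formula (I ⊕ Fin n), (∀ᶠ m in F, ψ.Realize (Sum.elim b m)) →
      ψ.Realize (Sum.elim b c) := fun ψ hψ =>
    (key ψ c).1 (hc _ (hψ.mono fun m hm => (key ψ m).2 hm))
  refine ⟨fun h => ?_, hmp φ⟩
  by_contra hF
  rw [← Ultrafilter.eventually_not] at hF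
  exact Formula.realize_not.1 (hmp φ.not (hF.mono fun m hm => Formula.realize_not.2 hm)) h

/-- Every type over an elementary substructure `M` extends to a global type that is finitely
satisfiable in `M`. -/
theorem exists_ultrafilter_coheir (M : L.ElementarySubstructure U) {n : ℕ} (a : Fin n → U) :
    ∃ F : Ultrafilter (Fin n → U), (∀ᶠ m : Fin n → U in F, ∀ i, m i ∈ M) ∧
      ∀ φ : L.Formula (M ⊕ Fin n), φ.Realize (Sum.elim Subtype.val a) →
        ∀ᶠ m in F, φ.Realize (Sum.elim Subtype.val m) := by
  let P := {φ : L.Formula (M ⊕ Fin n) // φ.Realize (Sum.elim Subtype.val a)}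
  let S : P → Set (Fin n → U) := fun φ =>
    {m | (∀ i, m i ∈ M) ∧ φ.1.Realize (Sum.elim Subtype.val m)}
  have : Nonempty P := ⟨⟨⊤, by simp⟩⟩
  have hne : ∀ φ, (S φ).Nonempty := fun φ => by
    have h : (φ.1.iExs (Fin n)).Realize ((M.subtype : M → U) ∘ id) :=
      Formula.realize_iExs.2 ⟨a, φ.2⟩
    rw [M.subtype.map_formula, Formula.realize_iExs] at h
    obtain ⟨m, hm⟩ := h
    rw [← M.subtype.map_formula, Sum.comp_elim] at hm
    exact ⟨fun i => m i, fun i => (m i).2, hm⟩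
  have hd : Directed (· ≥ ·) fun φ => 𝓟 (S φ) := fun φ ψ => by
    refine ⟨⟨φ.1 ⊓ ψ.1, Formula.realize_inf.2 ⟨φ.2, ψ.2⟩⟩, ?_, ?_⟩ <;>
      refine principal_mono.2 fun m hm => ⟨hm.1, ?_⟩
    exacts [(Formula.realize_inf.1 hm.2).1, (Formula.realize_inf.1 hm.2).2]
  have : (⨅ φ, 𝓟 (S φ)).NeBot :=
    iInf_neBot_of_directed' hd fun φ => principal_neBot_iff.2 (hne φ)
  obtain ⟨F, hF⟩ := Ultrafilter.exists_le (⨅ φ, 𝓟 (S φ))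
  have hmem : ∀ φ, ∀ᶠ m in F, m ∈ S φ := fun φ =>
    hF (mem_iInf_of_mem φ (mem_principal_self _))
  exact ⟨F, (hmem (Classical.arbitrary P)).mono fun m hm => hm.1,
    fun φ hφ => (hmem ⟨φ, hφ⟩).mono fun m hm => hm.2⟩

/-- A bounded equivalence relation on tuples (given as the kernel of `χ`) that is invariant under
`Aut(U/M)` is coarser than equality of types over the elementary substructure `M`. -/
theorem IsSaturated.rel_of_sameType (hsat : IsSaturated L U) (hU : ℵ₀ < #U)
    (M : L.ElementarySubstructure U) (hM : #M < #U) {n : ℕ} {κ : Type w} (hκ : #κ < #U)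
    (χ : (Fin n → U) → κ)
    (hχ : ∀ f : U ≃[L] U, (∀ m ∈ M, f m = m) → ∀ x y, χ x = χ y → χ (f ∘ x) = χ (f ∘ y))
    {a b : Fin n → U}
    (hab : SameType L (Sum.elim (Subtype.val : M → U) a) (Sum.elim (Subtype.val : M → U) b)) :
    χ a = χ b := by
  let tp (x : Fin n → U) : M ⊕ Fin n → U := Sum.elim Subtype.val x
  obtain ⟨F, hFM, hF⟩ := exists_ultrafilter_coheir M a
  -- One representative of each class that meets the type of `a` over `M`.
  obtain ⟨X, hX, hXbij⟩ := (surjOn_image χ {x | SameType L (tp x) (tp a)}).exists_bijOn_subset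
  let B : Set U := M ∪ (range a ∪ (range b ∪ ⋃ x : X, range x.1))
  have hfin : ∀ x : Fin n → U, #(range x) < #U := fun x => (finite_range x).lt_aleph0.trans hU
  have hXcard : #X < #U := (mk_le_of_injective hXbij.injOn.injective).trans_lt hκ
  have hB : #B < #U := by
    refine (mk_union_le _ _).trans_lt (add_lt_of_lt hU.le hM ?_)
    refine (mk_union_le _ _).trans_lt (add_lt_of_lt hU.le (hfin a) ?_)
    refine (mk_union_le _ _).trans_lt (add_lt_of_lt hU.le (hfin b) ?_)
    refine (mk_iUnion_le_sum_mk.trans (sum_le_sum _ (fun _ : X => ℵ₀) fun x : X =>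
      (finite_range x.1).lt_aleph0.le)).trans_lt ?_
    simpa using mul_lt_of_lt hU.le hXcard hU
  obtain ⟨c, hc⟩ := hsat.exists_realize_ultrafilter (L := L) F hB
  have hca : SameType L (tp c) (tp a) := .symm <| .of_imp fun φ hφ =>
    (hc M Subtype.val (fun i => .inl i.2) φ).2 (hF φ hφ)
  -- `F` concentrates on tuples `m` from `M`, and with `m` in place of `c` the formula belongs to
  -- the type over `M`.
  have key : ∀ x y : Fin n → U, range x ⊆ B → range y ⊆ B → SameType L (tp x) (tp y) →
      SameType L (Sum.elim (tp x) c) (Sum.elim (tp y) c) := fun x y hx hy hxy => by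
    have hmem : ∀ z : Fin n → U, range z ⊆ B → ∀ i, tp z i ∈ B := fun z hz i => by
      cases i with
      | inl m => exact .inl m.2
      | inr i => exact hz ⟨i, rfl⟩
    refine .of_imp fun φ hφ => (hc _ _ (hmem y hy) φ).2 ?_
    have hφx := (hc _ _ (hmem x hx) φ).1 hφ
    filter_upwards [hφx, hFM] with m hm hmM
    have := hxy (φ.relabel (Sum.elim id fun i => Sum.inl ⟨m i, hmM i⟩))
    simp only [Formula.realize_relabel, Sum.comp_elim, Function.comp_id] at this
    exact this.1 hm
  obtain ⟨x, hxX, hxc⟩ := hXbij.surjOn (mem_image_of_mem χ hca)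
  have hxa : SameType L (tp x) (tp a) := hX hxX
  have hxB : range x ⊆ B := fun u hu => .inr (.inr (.inr (mem_iUnion.2 ⟨⟨x, hxX⟩, hu⟩)))
  have hI : #((M ⊕ Fin n) ⊕ Fin n) < #U := by
    have hn : #(ULift.{w} (Fin n)) < #U := (lt_aleph0_of_finite _).trans hU
    simpa using add_lt_of_lt hU.le (add_lt_of_lt hU.le hM hn) hn
  -- By homogeneity some automorphism fixes `M` and `c` and sends `x` to `y`.
  have conj : ∀ y : Fin n → U, range y ⊆ B → SameType L (tp x) (tp y) → χ y = χ c :=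
    fun y hy hxy => by
      obtain ⟨f, hf⟩ := hsat.exists_equiv hU.le hI (key x y hxB hy hxy)
      have hfx : f ∘ x = y := funext fun i => hf (.inl (.inr i))
      have hfc : f ∘ c = c := funext fun i => hf (.inr i)
      rw [← hfx, ← hfc]
      exact hχ f (fun m hm => hf (.inl (.inl ⟨m, hm⟩))) x c hxc
  exact (conj a (fun u hu => .inr (.inl hu)) hxa).trans
    (conj b (fun u hu => .inr (.inr (.inl hu))) (hxa.trans hab)).symm

/-! ### Counting formulas. -/

theorem card_le_card_formula (L : FirstOrder.Language.{u, v}) :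
    L.card ≤ #(L.Formula ℕ) := by
  let g : L.Symbols → L.Formula ℕ := Sum.elim
    (fun f => Term.equal (Term.func f.2 fun _ => Term.var 0) (Term.var 0))
    (fun r => r.2.formula fun _ => Term.var 0)
  have hg : Function.Injective g := by
    rintro (⟨n, f⟩ | ⟨n, r⟩) (⟨m, f'⟩ | ⟨m, r'⟩) h
    · simp only [g, Sum.elim_inl, Term.equal, Term.bdEqual, Term.relabel] at h
      injection h with _ h
      injection h with h1 h2 h3
      subst h1
      obtain rfl := eq_of_heq h2
      rfl
    · cases h
    · cases h
    · simp only [g, Sum.elim_inr, Relations.formula, Relations.boundedFormula] at h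
      injection h with _ h1 h2
      subst h1
      obtain rfl := eq_of_heq h2
      rfl
  exact mk_le_of_injective hg

theorem aleph0_le_card_formula (L : FirstOrder.Language.{u, v}) : ℵ₀ ≤ #(L.Formula ℕ) := by
  have hg : Function.Injective
      fun i : ℕ => (Term.equal (Term.var i) (Term.var i) : L.Formula ℕ) := fun i j h => by
    simp only [Term.equal, Term.bdEqual, Term.relabel] at h
    injection h with _ h
    injection h with h
    exact Sum.inl_injective h
  simpa using lift_mk_le_lift_mk_of_injective hg

theorem card_formula_le (L : FirstOrder.Language.{u, v}) (I : Type w) :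
    #(L.Formula I) ≤
      max ℵ₀ (Cardinal.lift.{max u v} #I + Cardinal.lift.{w} L.card) :=
  (mk_le_of_injective (f := fun φ : L.Formula I => (⟨0, φ⟩ : Σ n, L.BoundedFormula I n))
    fun _ _ h => eq_of_heq (Sigma.mk.inj h).2).trans BoundedFormula.card_le

theorem lift_mk_le_cardFormulas (L : FirstOrder.Language.{u, v}) (A : Set U) :
    Cardinal.lift.{max u v} #A ≤ cardFormulas L A :=
  calc Cardinal.lift.{max u v} #A ≤ L[[A]].card := by
        rw [card_withConstants]; simp
    _ ≤ _ := card_le_card_formula L[[A]]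

theorem lift_card_le_cardFormulas (L : FirstOrder.Language.{u, v}) (A : Set U) :
    Cardinal.lift.{w} L.card ≤ cardFormulas L A :=
  calc Cardinal.lift.{w} L.card ≤ L[[A]].card := by
        rw [card_withConstants]; simp
    _ ≤ _ := card_le_card_formula L[[A]]

theorem aleph0_le_cardFormulas (L : FirstOrder.Language.{u, v}) (A : Set U) :
    ℵ₀ ≤ cardFormulas L A :=
  aleph0_le_card_formula _

theorem cardFormulas_lt {U : Type w} (hU : ℵ₀ < #U)
    (hL : Cardinal.lift.{w} L.card < Cardinal.lift.{max u v} #U)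
    {A : Set U} (hA : #A < #U) : cardFormulas L A < Cardinal.lift.{max u v} #U := by
  have hU' : ℵ₀ < Cardinal.lift.{max u v} #U := by simpa using hU
  refine (card_formula_le _ _).trans_lt (max_lt hU' (add_lt_of_lt hU'.le (by simpa using hU) ?_))
  rw [lift_uzero, card_withConstants]
  exact add_lt_of_lt hU'.le hL (lift_lt.2 hA)

/-! ### The bound on the orbit. -/

/-- If the orbit of `D` over `A` is small, then it is bounded by the number of sets of types over
an elementary substructure containing `A`. -/
theorem card_orbit_le (hsat : IsSaturated L U) (hinacc : (#U).IsInaccessible)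
    (hL : Cardinal.lift.{w} L.card < Cardinal.lift.{max u v} #U) {A : Set U} (hA : #A < #U)
    {n : ℕ} {D : Set (Fin n → U)} (hD : #(orbit L A D) < #U) :
    Cardinal.lift.{max u v} #(orbit L A D) ≤
      (2 : Cardinal.{max u v w}) ^ ((2 : Cardinal.{max u v w}) ^ cardFormulas L A) := by
  have hlt := cardFormulas_lt hinacc.aleph0_lt hL hA
  obtain ⟨M, hAM, hMcard⟩ := exists_elementarySubstructure_card_eq L A (cardFormulas L A)
    (aleph0_le_cardFormulas L A)
    (by
      rw [lift_umax.{w, max u v}, lift_id'.{w, max u v w}]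
      exact lift_mk_le_cardFormulas L A)
    (by
      rw [lift_umax.{max u v, w}, lift_id'.{max u v, max u v w}]
      exact lift_card_le_cardFormulas L A)
    (by
      rw [lift_umax.{w, max u v}, lift_id'.{w, max u v w}]
      exact hlt.le)
  have hMcard : Cardinal.lift.{max u v} #M = cardFormulas L A := by
    rwa [lift_umax.{w, max u v}, lift_id'.{w, max u v w}] at hMcard
  have hM : #M < #U := by rwa [← hMcard, lift_lt] at hlt
  let χ : (Fin n → U) → Set (orbit L A D) := fun x => {C | x ∈ C.1}
  have hχ : ∀ f : U ≃[L] U, (∀ m ∈ M, f m = m) → ∀ x y, χ x = χ y → χ (f ∘ x) = χ (f ∘ y) := by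
    intro f hf x y hxy
    ext ⟨C, g, hg, hC⟩
    -- The preimage of `C` under `f` is again in the orbit, since `f` fixes `M ⊇ A`.
    have hinv : ∀ z : Fin n → U, f ∘ z ∈ C ↔ z ∈ (fun t => (f.symm.comp g) ∘ t) '' D := by
      intro z
      rw [hC]
      refine exists_congr fun t => and_congr_right fun _ => ?_
      constructor
      · intro h
        funext i
        have := congrFun h i
        simp only [Function.comp_apply] at this
        simp [this]
      · rintro rfl
        funext i
        simp
    have hmem : (fun t => (f.symm.comp g) ∘ t) '' D ∈ orbit L A D :=
      ⟨f.symm.comp g, fun a ha => by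
        have := hf a (hAM ha)
        simp only [Equiv.comp_apply, hg a ha]
        exact f.injective (by simp [this]), rfl⟩
    have := Set.ext_iff.1 hxy ⟨_, hmem⟩
    exact (hinv x).trans (this.trans (hinv y).symm)
  have hrel := fun a b => hsat.rel_of_sameType (a := a) (b := b) hinacc.aleph0_lt M hM
    (by simpa using hinacc.isStrongPrelimit hD) χ hχ
  let tp : (Fin n → U) → Set (L.Formula (M ⊕ Fin n)) :=
    fun x => {φ | φ.Realize (Sum.elim Subtype.val x)}
  have hinj : Function.Injective fun C : orbit L A D => tp '' C.1 := by
    have hsub : ∀ C C' : orbit L A D, tp '' C.1 = tp '' C'.1 → C.1 ⊆ C'.1 := fun C C' h x hx => by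
      obtain ⟨y, hy, hxy⟩ := h ▸ mem_image_of_mem tp hx
      have := hrel y x fun φ => Set.ext_iff.1 hxy φ
      exact (Set.ext_iff.1 this C').1 hy
    exact fun C C' h => Subtype.ext ((hsub C C' h).antisymm (hsub C' C h.symm))
  have hform : #(L.Formula (M ⊕ Fin n)) ≤ cardFormulas L A := by
    refine (card_formula_le _ _).trans (max_le (aleph0_le_cardFormulas L A)
      (add_le_of_le (aleph0_le_cardFormulas L A) ?_ (lift_card_le_cardFormulas L A)))
    rw [mk_sum, lift_add, lift_lift, lift_lift]
    refine add_le_of_le (aleph0_le_cardFormulas L A) (by simpa using hMcard.le) ?_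
    simpa using natCast_le_aleph0.trans (aleph0_le_cardFormulas L A)
  have := lift_mk_le_lift_mk_of_injective hinj
  rw [mk_set, mk_set] at this
  refine (le_of_eq_of_le ?_ this).trans ?_
  · exact (lift_umax.{w, max u v}).symm ▸ rfl
  · rw [lift_two_power, lift_two_power, lift_id'.{w, max u v w}]
    exact power_le_power_left two_ne_zero (power_le_power_left two_ne_zero hform)

/-- A cardinal below a lift is itself a lift, so the strong limit property passes to the larger
universe. -/
theorem two_power_lt_lift {c : Cardinal.{w}} (hc : c.IsInaccessible)
    {d : Cardinal.{max u w}} (hd : d < Cardinal.lift.{u} c) :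
    (2 : Cardinal.{max u w}) ^ d < Cardinal.lift.{u} c := by
  obtain ⟨e, he, rfl⟩ := lt_lift_iff.1 hd
  rw [← lift_two_power, lift_lt]
  exact hc.isStrongPrelimit (by simpa using hd)

end LascarOrbit

theorem mainTheorem10 (L : FirstOrder.Language.{u, v}) (U : Type w) [L.Structure U]
    (hsat : LascarOrbit.IsSaturated L U)
    (hinacc : (#U).IsInaccessible)
    (hL : Cardinal.lift.{w} L.card < Cardinal.lift.{max u v} #U)
    (A : Set U) (hA : #A < #U)
    (n : ℕ) (D : Set (Fin n → U)) :
    #(LascarOrbit.orbit L A D) < #U ↔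
      Cardinal.lift.{max u v} #(LascarOrbit.orbit L A D) ≤
        (2 : Cardinal.{max u v w}) ^ ((2 : Cardinal.{max u v w}) ^ LascarOrbit.cardFormulas L A) := by
  refine ⟨LascarOrbit.card_orbit_le hsat hinacc hL hA, fun h => ?_⟩
  exact lift_lt.1 (h.trans_lt (LascarOrbit.two_power_lt_lift hinacc
    (LascarOrbit.two_power_lt_lift hinacc
      (LascarOrbit.cardFormulas_lt hinacc.aleph0_lt hL hA))))
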